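/- Let $E=(E^0,E^1,r,s)$ be an arbitrary directed graph (sets $E^0$ of vertices and $E^1$ of edges, maps $r,s:E^1\to E^0$; no finiteness condition is imposed) and let $K$ be a field. The Leavitt path algebra $L_K(E)$ is the (not necessarily unital) associative $K$-algebra generated by a set $\{v\mid v\in E^0\}$ of pairwise orthogonal idempotents together with $\{e,e^*\mid e\in E^1\}$, subject to the relations: (1) $s(e)e=e\,r(e)=e$ for all $e\in E^1$; (2) $r(e)e^*=e^*s(e)=e^*$ for all $e\in E^1$; (3) $e^*e'=\delta_{e,e'}\,r(e)$ for all $e,e'\in E^1$; (4) $v=\sum_{e\in s^{-1}(v)}ee^*$ for every $v\in E^0$ with $s^{-1}(v)$ finite and nonempty. A path is a finite sequence of edges $e_1\cdots e_n$ with $r(e_i)=s(e_{i+1})$ for $1\le i<n$; its source is $s(e_1)$ and its range is $r(e_n)$. Each vertex $v$ is also a path of length $0$ with source and range $v$. The tree $T(u)$ of a vertex $u$ is the set of all $w\in E^0$ such that there is a path with source $u$ and range $w$. There is a bifurcation at $w$ if $s^{-1}(w)$ has at least two elements. A cycle at $w$ is a path $e_1\cdots e_n$ with $n\ge 1$, with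 source and range $w$, and with $s(e_i)\ne s(e_j)$ for $i\ne j$. A vertex $u$ is a line point if there are neither bifurcations nor cycles at any vertex $w\in T(u)$. A left ideal $I$ of an algebra is minimal if it is nonzero and the only left ideals that it contains are $0$ and $I$. **Theorem.** For every vertex $u\in E^0$, the left ideal $L_K(E)u$ is a minimal left ideal of $L_K(E)$ if and only if $u$ is a line point. -/

import Mathlib

/-- A directed graph `(E⁰, E¹, r, s)` with vertex set `V = E⁰` and edge set `A = E¹`.
Loops, parallel edges, sinks and infinite emitters are all allowed. -/
structure DirectedGraph (V : Type*) (A : Type*) where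
  /-- the source map `s` -/
  source : A → V
  /-- the range map `r` -/
  range : A → V

namespace DirectedGraph

variable {V : Type*} {A : Type*}

/-- `s⁻¹(v)`: the edges emitted by `v`. -/
def emitted (E : DirectedGraph V A) (v : V) : Set A :=
  {e | E.source e = v}

/-- A regular vertex: it is neither a sink nor an infinite emitter. -/
def IsRegular (E : DirectedGraph V A) (v : V) : Prop :=
  (E.emitted v).Nonempty ∧ (E.emitted v).Finite

/-- `E.IsPath v p w`: the sequence of edges `p` is a path with source `v` and range `w`.
The empty sequence is the path of length zero at `v`. -/
def IsPath (E : DirectedGraph V A) : V → List A → V → Prop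
  | v, [], w => v = w
  | v, e :: p, w => E.source e = v ∧ IsPath E (E.range e) p w

/-- The tree `T(v)`: all vertices `w` such that some path has source `v` and range `w`. -/
def tree (E : DirectedGraph V A) (v : V) : Set V :=
  {w | ∃ p : List A, E.IsPath v p w}

/-- A cycle based at `v`: a path of positive length with source and range `v` whose edges have
pairwise distinct sources. -/
def IsCycleAt (E : DirectedGraph V A) (v : V) (p : List A) : Prop :=
  p ≠ [] ∧ E.IsPath v p v ∧ (p.map E.source).Nodup

/-- There is a bifurcation at `v`: the vertex `v` emits at least two edges. -/
def IsBifurcation (E : DirectedGraph V A) (v : V) : Prop :=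
  (E.emitted v).Nontrivial

/-- A line point: there are neither bifurcations nor cycles at any vertex of its tree. -/
def IsLinePoint (E : DirectedGraph V A) (u : V) : Prop :=
  ∀ w ∈ E.tree u, ¬ E.IsBifurcation w ∧ ¬ ∃ p : List A, E.IsCycleAt w p

/-- The generators of the Leavitt path algebra: vertices, (real) edges and ghost edges. -/
inductive LeavittGen (V : Type*) (A : Type*)
  | vertex (v : V)
  | edge (e : A)
  | ghost (e : A)

open LeavittGen in
/-- The defining relations of the Leavitt path algebra, in the free unital algebra on the
generators: the vertices are pairwise orthogonal idempotents, and (1) - (4) hold. -/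
inductive LeavittRel (K : Type*) [Field K] (E : DirectedGraph V A) :
    FreeAlgebra K (LeavittGen V A) → FreeAlgebra K (LeavittGen V A) → Prop
  | idem (v : V) :
      LeavittRel K E (FreeAlgebra.ι K (vertex v) * FreeAlgebra.ι K (vertex v))
        (FreeAlgebra.ι K (vertex v))
  | orth (v w : V) (h : v ≠ w) :
      LeavittRel K E (FreeAlgebra.ι K (vertex v) * FreeAlgebra.ι K (vertex w)) 0
  /-- (1) `s(e) e = e = e r(e)` -/
  | source_edge (e : A) :
      LeavittRel K E (FreeAlgebra.ι K (vertex (E.source e)) * FreeAlgebra.ι K (edge e))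
        (FreeAlgebra.ι K (edge e))
  | edge_range (e : A) :
      LeavittRel K E (FreeAlgebra.ι K (edge e) * FreeAlgebra.ι K (vertex (E.range e)))
        (FreeAlgebra.ι K (edge e))
  /-- (2) `r(e) e* = e* = e* s(e)` -/
  | range_ghost (e : A) :
      LeavittRel K E (FreeAlgebra.ι K (vertex (E.range e)) * FreeAlgebra.ι K (ghost e))
        (FreeAlgebra.ι K (ghost e))
  | ghost_source (e : A) :
      LeavittRel K E (FreeAlgebra.ι K (ghost e) * FreeAlgebra.ι K (vertex (E.source e)))
        (FreeAlgebra.ι K (ghost e))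
  /-- (3) `e* e' = δ_{e,e'} r(e)` -/
  | ghost_edge_self (e : A) :
      LeavittRel K E (FreeAlgebra.ι K (ghost e) * FreeAlgebra.ι K (edge e))
        (FreeAlgebra.ι K (vertex (E.range e)))
  | ghost_edge_ne (e f : A) (h : e ≠ f) :
      LeavittRel K E (FreeAlgebra.ι K (ghost e) * FreeAlgebra.ι K (edge f)) 0
  /-- (4) `v = ∑_{s(e) = v} e e*` for every regular vertex `v` -/
  | regular (v : V) (h : E.IsRegular v) :
      LeavittRel K E (FreeAlgebra.ι K (vertex v))
        (∑ e ∈ h.2.toFinset, FreeAlgebra.ι K (edge e) * FreeAlgebra.ι K (ghost e))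

/-- The unital `K`-algebra given by the generators and relations of the Leavitt path algebra.
Since no relation involves the unit, it is the Leavitt path algebra with a unit freely adjoined. -/
abbrev UnitalLeavitt (K : Type*) [Field K] (E : DirectedGraph V A) : Type _ :=
  RingQuot (LeavittRel K E)

/-- The image of a generator. -/
def leavittGen (K : Type*) [Field K] (E : DirectedGraph V A) (x : LeavittGen V A) :
    UnitalLeavitt K E :=
  RingQuot.mkAlgHom K (LeavittRel K E) (FreeAlgebra.ι K x)

/-- The Leavitt path algebra `L_K(E)`: the (not necessarily unital) `K`-algebra generated by
vertices, edges and ghost edges subject to the relations. It is realized as the non-unital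
subalgebra that the generators span inside the unital algebra with the same presentation; no
unit is added, so it is the universal non-unital algebra with these generators and relations. -/
abbrev LeavittPathAlgebra (K : Type*) [Field K] (E : DirectedGraph V A) : Type _ :=
  ↥(NonUnitalAlgebra.adjoin K (Set.range (leavittGen K E)))

/-- The vertex `v` as an element of `L_K(E)`. -/
def vertexElem (K : Type*) [Field K] (E : DirectedGraph V A) (v : V) : LeavittPathAlgebra K E :=
  ⟨leavittGen K E (LeavittGen.vertex v), NonUnitalAlgebra.subset_adjoin K ⟨_, rfl⟩⟩

end DirectedGraph

section LeftIdeals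

variable {K : Type*} [Field K] {R : Type*} [NonUnitalRing R] [Module K R]

/-- A left ideal of a not necessarily unital `K`-algebra `R`: a `K`-subspace closed under left
multiplication by elements of `R`. -/
def IsLeftIdeal (I : Submodule K R) : Prop :=
  ∀ a : R, ∀ x ∈ I, a * x ∈ I

/-- A minimal left ideal: a nonzero left ideal that contains no left ideals besides `0` and
itself. -/
def IsMinimalLeftIdeal (I : Submodule K R) : Prop :=
  IsLeftIdeal I ∧ I ≠ ⊥ ∧ ∀ J : Submodule K R, IsLeftIdeal J → J ≤ I → J = ⊥ ∨ J = I

/-- The left ideal `R u = {a u | a ∈ R}`. -/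
def leftMultiples (K : Type*) [Field K] {R : Type*} [NonUnitalRing R] [Module K R]
    [IsScalarTower K R R] (u : R) : Submodule K R where
  carrier := {x | ∃ a : R, a * u = x}
  add_mem' := by
    rintro _ _ ⟨a, rfl⟩ ⟨b, rfl⟩
    exact ⟨a + b, add_mul a b u⟩
  zero_mem' := ⟨0, zero_mul u⟩
  smul_mem' := by
    rintro k _ ⟨a, rfl⟩
    exact ⟨k • a, smul_mul_assoc k a u⟩

end LeftIdeals

/-! Write `L` for the algebra. Suppose `u` is a line point and `x = xu` is a nonzero element of a
left ideal inside `Lu`. The algebra is spanned by monomials `p w q*`. Paths leaving `u` are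
comparable, so right multiplication by one long enough path `q` from `u` to some `w` removes all
ghost edges from `x`. Nothing is lost, because `q w q* = u` in the absence of bifurcations. Now `xq`
is a combination of elements `p w`. No closed path of positive length passes through `w`, so
distinct paths ending at `w` are orthogonal, and some `w p*` sends `xq` to a nonzero multiple of
`w`. Hence `u` lies in the ideal (`IsLinePoint.exists_mul_eq_vertex`).

Conversely, minimality of `Lu` makes every nonzero element of the corner `uLu` generate `Lu`, and
this property passes along paths to each `w` in the tree (`IsCornerMinimal.of_isPath`). At a
bifurcation, `ee*` fails to generate because another edge `f` has `ee*f = 0`. At a cycle `c` without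
bifurcations, `w - c` fails to generate. That vertices and `w - c` are nonzero, and that `w - c` has
no left inverse, is read off from representations on functions `V × κ → R`, with a twist `t` by
which every edge is scaled: `t = X` shows `w - c ≠ 0`, and `t = 1` gives a vector killed by `w - c`
but not by `w`. -/

namespace DirectedGraph

open LeavittGen

/-! ### Products of vertices, edges and ghost edges -/

section Relations

variable {V : Type*} {A : Type*} (K : Type*) [Field K] (E : DirectedGraph V A)

theorem leavittGen_vertex_mul_self (v : V) :
    E.leavittGen K (vertex v) * E.leavittGen K (vertex v) = E.leavittGen K (vertex v) := by
  simpa [leavittGen] using RingQuot.mkAlgHom_rel K (LeavittRel.idem (K := K) (E := E) v)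

theorem leavittGen_vertex_mul_vertex_of_ne {v w : V} (h : v ≠ w) :
    E.leavittGen K (vertex v) * E.leavittGen K (vertex w) = 0 := by
  simpa [leavittGen] using RingQuot.mkAlgHom_rel K (LeavittRel.orth (K := K) (E := E) v w h)

theorem leavittGen_source_mul_edge (e : A) :
    E.leavittGen K (vertex (E.source e)) * E.leavittGen K (edge e) = E.leavittGen K (edge e) := by
  simpa [leavittGen] using RingQuot.mkAlgHom_rel K (LeavittRel.source_edge (K := K) (E := E) e)

theorem leavittGen_edge_mul_range (e : A) :
    E.leavittGen K (edge e) * E.leavittGen K (vertex (E.range e)) = E.leavittGen K (edge e) := by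
  simpa [leavittGen] using RingQuot.mkAlgHom_rel K (LeavittRel.edge_range (K := K) (E := E) e)

theorem leavittGen_range_mul_ghost (e : A) :
    E.leavittGen K (vertex (E.range e)) * E.leavittGen K (ghost e) = E.leavittGen K (ghost e) := by
  simpa [leavittGen] using RingQuot.mkAlgHom_rel K (LeavittRel.range_ghost (K := K) (E := E) e)

theorem leavittGen_ghost_mul_source (e : A) :
    E.leavittGen K (ghost e) * E.leavittGen K (vertex (E.source e)) = E.leavittGen K (ghost e) := by
  simpa [leavittGen] using RingQuot.mkAlgHom_rel K (LeavittRel.ghost_source (K := K) (E := E) e)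

theorem leavittGen_ghost_mul_edge_self (e : A) :
    E.leavittGen K (ghost e) * E.leavittGen K (edge e) = E.leavittGen K (vertex (E.range e)) := by
  simpa [leavittGen] using RingQuot.mkAlgHom_rel K (LeavittRel.ghost_edge_self (K := K) (E := E) e)

theorem leavittGen_ghost_mul_edge_of_ne {e f : A} (h : e ≠ f) :
    E.leavittGen K (ghost e) * E.leavittGen K (edge f) = 0 := by
  simpa [leavittGen] using
    RingQuot.mkAlgHom_rel K (LeavittRel.ghost_edge_ne (K := K) (E := E) e f h)

theorem leavittGen_vertex_eq_sum (v : V) (h : E.IsRegular v) :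
    E.leavittGen K (vertex v) =
      ∑ e ∈ h.2.toFinset, E.leavittGen K (edge e) * E.leavittGen K (ghost e) := by
  simpa [leavittGen] using RingQuot.mkAlgHom_rel K (LeavittRel.regular (K := K) (E := E) v h)

theorem leavittGen_vertex_mul_edge_of_ne {v : V} {e : A} (h : v ≠ E.source e) :
    E.leavittGen K (vertex v) * E.leavittGen K (edge e) = 0 := by
  rw [← leavittGen_source_mul_edge, ← mul_assoc, leavittGen_vertex_mul_vertex_of_ne K E h,
    zero_mul]

theorem leavittGen_edge_mul_vertex_of_ne {v : V} {e : A} (h : E.range e ≠ v) :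
    E.leavittGen K (edge e) * E.leavittGen K (vertex v) = 0 := by
  rw [← leavittGen_edge_mul_range, mul_assoc, leavittGen_vertex_mul_vertex_of_ne K E h,
    mul_zero]

theorem leavittGen_ghost_mul_vertex_of_ne {v : V} {e : A} (h : E.source e ≠ v) :
    E.leavittGen K (ghost e) * E.leavittGen K (vertex v) = 0 := by
  rw [← leavittGen_ghost_mul_source, mul_assoc, leavittGen_vertex_mul_vertex_of_ne K E h,
    mul_zero]

/-- Only one edge leaves `v`, so the sum in relation (4) has a single term. -/
theorem leavittGen_vertex_eq_edge_mul_ghost {v : V} {e : A} (he : E.source e = v)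
    (h : ¬ E.IsBifurcation v) :
    E.leavittGen K (edge e) * E.leavittGen K (ghost e) = E.leavittGen K (vertex v) := by
  have hs : E.emitted v = {e} := by
    refine Set.Subsingleton.eq_singleton_of_mem (Set.not_nontrivial_iff.1 h) he
  have hr : E.IsRegular v := by
    simp [IsRegular, hs]
  rw [leavittGen_vertex_eq_sum K E v hr]
  have : hr.2.toFinset = {e} := by ext; simp [hs]
  rw [this, Finset.sum_singleton]

/-- The product of the edges of a list. -/
def pathElem (p : List A) : UnitalLeavitt K E :=
  (p.map fun e => E.leavittGen K (edge e)).prod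

/-- The product, in reverse order, of the ghost edges of a list. -/
def ghostPathElem (p : List A) : UnitalLeavitt K E :=
  (p.reverse.map fun e => E.leavittGen K (ghost e)).prod

@[simp] theorem pathElem_nil : E.pathElem K [] = 1 := by simp [pathElem]

@[simp] theorem ghostPathElem_nil : E.ghostPathElem K [] = 1 := by simp [ghostPathElem]

theorem pathElem_cons (e : A) (p : List A) :
    E.pathElem K (e :: p) = E.leavittGen K (edge e) * E.pathElem K p := by simp [pathElem]

theorem pathElem_append (p q : List A) :
    E.pathElem K (p ++ q) = E.pathElem K p * E.pathElem K q := by simp [pathElem]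

theorem ghostPathElem_cons (e : A) (p : List A) :
    E.ghostPathElem K (e :: p) = E.ghostPathElem K p * E.leavittGen K (ghost e) := by
  simp [ghostPathElem]

theorem ghostPathElem_concat (p : List A) (e : A) :
    E.ghostPathElem K (p ++ [e]) = E.leavittGen K (ghost e) * E.ghostPathElem K p := by
  simp [ghostPathElem]

variable {K E}

theorem IsPath.vertex_mul_pathElem {v w : V} {p : List A} (h : E.IsPath v p w) :
    E.leavittGen K (vertex v) * E.pathElem K p = E.pathElem K p * E.leavittGen K (vertex w) := by
  induction p generalizing v with
  | nil => obtain rfl : v = w := h; simp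
  | cons e p ih =>
    obtain ⟨rfl, h⟩ := h
    rw [pathElem_cons, ← mul_assoc, leavittGen_source_mul_edge, mul_assoc, ← ih h, ← mul_assoc,
      leavittGen_edge_mul_range]

theorem IsPath.ghostPathElem_mul_vertex {v w : V} {p : List A} (h : E.IsPath v p w) :
    E.ghostPathElem K p * E.leavittGen K (vertex v) =
      E.leavittGen K (vertex w) * E.ghostPathElem K p := by
  induction p generalizing v with
  | nil => obtain rfl : v = w := h; simp
  | cons e p ih =>
    obtain ⟨rfl, h⟩ := h
    rw [ghostPathElem_cons, mul_assoc, leavittGen_ghost_mul_source, ← mul_assoc, ← ih h, mul_assoc,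
      leavittGen_range_mul_ghost]

/-- Relation (3) cancels the edges from the inside out. The factor `w` is needed because the empty
list gives the adjoined unit, not a vertex. -/
theorem IsPath.ghostPathElem_mul_pathElem {v w : V} {p : List A} (h : E.IsPath v p w) :
    E.ghostPathElem K p * (E.pathElem K p * E.leavittGen K (vertex w)) =
      E.leavittGen K (vertex w) := by
  induction p generalizing v with
  | nil => simp
  | cons e p ih =>
    obtain ⟨rfl, h⟩ := h
    calc _ = E.ghostPathElem K p * ((E.leavittGen K (ghost e) * E.leavittGen K (edge e)) *
          (E.pathElem K p * E.leavittGen K (vertex w))) := by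
          simp only [ghostPathElem_cons, pathElem_cons, mul_assoc]
      _ = _ := by
        rw [leavittGen_ghost_mul_edge_self, ← h.vertex_mul_pathElem, ← mul_assoc _ _ (pathElem _ _ _),
          leavittGen_vertex_mul_self, h.vertex_mul_pathElem, ih h]

/-- The spanning families below run over all lists of edges; this discards those that are not paths.
-/
theorem pathElem_mul_vertex_eq_zero_or (p : List A) (w : V) :
    E.pathElem K p * E.leavittGen K (vertex w) = 0 ∨ ∃ v, E.IsPath v p w := by
  induction p with
  | nil => exact Or.inr ⟨w, rfl⟩
  | cons e p ih =>
    rw [pathElem_cons, mul_assoc]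
    rcases ih with h | ⟨v, h⟩
    · exact Or.inl (by rw [h, mul_zero])
    · by_cases hv : E.range e = v
      · exact Or.inr ⟨E.source e, rfl, hv ▸ h⟩
      · left
        rw [← h.vertex_mul_pathElem, ← mul_assoc, leavittGen_edge_mul_vertex_of_ne K E hv, zero_mul]

theorem vertex_mul_ghostPathElem_mul_vertex_eq_zero_or (p : List A) (v w : V) :
    E.leavittGen K (vertex w) * E.ghostPathElem K p * E.leavittGen K (vertex v) = 0 ∨
      E.IsPath v p w := by
  induction p generalizing v with
  | nil =>
    by_cases h : w = v
    · exact Or.inr h.symm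
    · left; simp [leavittGen_vertex_mul_vertex_of_ne K E h]
  | cons e p ih =>
    rw [ghostPathElem_cons]
    by_cases hv : E.source e = v
    · rcases ih (E.range e) with h | h
      · left
        rw [← leavittGen_range_mul_ghost, ← mul_assoc, ← mul_assoc, h, zero_mul, zero_mul]
      · exact Or.inr ⟨hv, h⟩
    · left
      simp only [mul_assoc]
      rw [leavittGen_ghost_mul_vertex_of_ne K E hv, mul_zero, mul_zero]

/-! ### Paths and cycles; products at line points -/

theorem IsPath.append {u v w : V} {p q : List A} (hp : E.IsPath u p v) (hq : E.IsPath v q w) :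
    E.IsPath u (p ++ q) w := by
  induction p generalizing u with
  | nil => obtain rfl : u = v := hp; exact hq
  | cons e p ih => exact ⟨hp.1, ih hp.2⟩

theorem IsPath.exists_of_append {u w : V} {p q : List A} (h : E.IsPath u (p ++ q) w) :
    ∃ v, E.IsPath u p v ∧ E.IsPath v q w := by
  induction p generalizing u with
  | nil => exact ⟨u, rfl, h⟩
  | cons e p ih =>
    obtain ⟨v, h1, h2⟩ := ih h.2
    exact ⟨v, ⟨h.1, h1⟩, h2⟩

theorem mem_tree_trans {u v w : V} (hv : v ∈ E.tree u) (hw : w ∈ E.tree v) : w ∈ E.tree u := by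
  obtain ⟨p, hp⟩ := hv
  obtain ⟨q, hq⟩ := hw
  exact ⟨p ++ q, hp.append hq⟩

theorem IsLinePoint.of_mem_tree {u v : V} (hu : E.IsLinePoint u) (hv : v ∈ E.tree u) :
    E.IsLinePoint v :=
  fun _ hw => hu _ (mem_tree_trans hv hw)

/-- A vertex on a closed path of positive length has a cycle in its tree. -/
theorem IsPath.exists_isCycleAt {w : V} {p : List A} (h : E.IsPath w p w) (hp : p ≠ []) :
    ∃ v ∈ E.tree w, ∃ c, E.IsCycleAt v c := by
  induction hn : p.length using Nat.strong_induction_on generalizing w p with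
  | _ n ih =>
    by_cases hd : (p.map E.source).Nodup
    · exact ⟨w, ⟨[], rfl⟩, p, hp, h, hd⟩
    · have : ∃ a b d : List A, ∃ e f : A, p = a ++ (e :: b ++ f :: d) ∧ E.source e = E.source f := by
        clear ih hn h hp
        induction p with
        | nil => simp at hd
        | cons e p ihp =>
          rw [List.map_cons, List.nodup_cons, not_and_or, not_not] at hd
          rcases hd with hd | hd
          · obtain ⟨f, hf, hfe⟩ := List.mem_map.1 hd
            obtain ⟨b, d, rfl⟩ := List.append_of_mem hf
            exact ⟨[], b, d, e, f, rfl, hfe.symm⟩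
          · obtain ⟨a, b, d, e', f, rfl, h⟩ := ihp hd
            exact ⟨e :: a, b, d, e', f, rfl, h⟩
      obtain ⟨a, b, d, e, f, rfl, hef⟩ := this
      obtain ⟨v, h1, h2⟩ := h.exists_of_append
      obtain ⟨v', h3, h4⟩ := h2.exists_of_append
      -- The segment `e :: b` between two edges with the same source is a shorter closed path.
      have : v' = v := by rw [← h4.1, ← hef, h3.1]
      subst this
      obtain ⟨x, hx, hc⟩ := ih (e :: b).length (by simp at hn ⊢; omega) h3 (by simp) rfl
      exact ⟨x, mem_tree_trans ⟨a, h1⟩ hx, hc⟩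

theorem IsLinePoint.eq_nil_of_isPath {w : V} (hw : E.IsLinePoint w) {p : List A}
    (h : E.IsPath w p w) : p = [] := by
  by_contra hp
  obtain ⟨v, hv, hc⟩ := h.exists_isCycleAt hp
  exact (hw v hv).2 hc

/-- Two paths starting at a line point are comparable. -/
theorem IsLinePoint.exists_append_of_isPath {u v w : V} (hu : E.IsLinePoint u) {p q : List A}
    (hp : E.IsPath u p v) (hq : E.IsPath u q w) :
    (∃ t, E.IsPath v t w ∧ q = p ++ t) ∨ ∃ t, E.IsPath w t v ∧ p = q ++ t := by
  induction p generalizing u q with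
  | nil => obtain rfl : u = v := hp; exact Or.inl ⟨q, hq, rfl⟩
  | cons e p ih =>
    cases q with
    | nil => obtain rfl : u = w := hq; exact Or.inr ⟨_, hp, rfl⟩
    | cons f q =>
      obtain rfl : e = f := Set.not_nontrivial_iff.1 (hu u ⟨[], rfl⟩).1 hp.1 hq.1
      rcases ih (hu.of_mem_tree ⟨[e], hp.1, rfl⟩) hp.2 hq.2 with ⟨t, ht, rfl⟩ | ⟨t, ht, rfl⟩
      · exact Or.inl ⟨t, ht, rfl⟩
      · exact Or.inr ⟨t, ht, rfl⟩

theorem IsLinePoint.pathElem_mul_ghostPathElem {u w : V} (hu : E.IsLinePoint u) {q : List A}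
    (hq : E.IsPath u q w) :
    E.pathElem K q * (E.leavittGen K (vertex w) * E.ghostPathElem K q) =
      E.leavittGen K (vertex u) := by
  induction q generalizing u with
  | nil => obtain rfl : u = w := hq; simp
  | cons e q ih =>
    have h := ih (hu.of_mem_tree ⟨[e], hq.1, rfl⟩) hq.2
    calc _ = E.leavittGen K (edge e) * (E.pathElem K q * (E.leavittGen K (vertex w) *
          E.ghostPathElem K q)) * E.leavittGen K (ghost e) := by
          simp only [ghostPathElem_cons, pathElem_cons, mul_assoc]
      _ = _ := by
        rw [h, leavittGen_edge_mul_range,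
          leavittGen_vertex_eq_edge_mul_ghost K E hq.1 (hu u ⟨[], rfl⟩).1]

theorem IsLinePoint.ghostPathElem_mul_pathElem_of_ne {v w : V} (hw : E.IsLinePoint w)
    {p q : List A} (hp : E.IsPath v p w) (hq : E.IsPath v q w) (hpq : p ≠ q) :
    E.ghostPathElem K p * (E.pathElem K q * E.leavittGen K (vertex w)) = 0 := by
  induction p generalizing v q with
  | nil =>
    obtain rfl : v = w := hp
    exact absurd (hw.eq_nil_of_isPath hq).symm hpq
  | cons e p ih =>
    cases q with
    | nil =>
      obtain rfl : v = w := hq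
      exact absurd (hw.eq_nil_of_isPath hp) hpq
    | cons f q =>
      have key : E.ghostPathElem K (e :: p) * (E.pathElem K (f :: q) * E.leavittGen K (vertex w)) =
          E.ghostPathElem K p * ((E.leavittGen K (ghost e) * E.leavittGen K (edge f)) *
          (E.pathElem K q * E.leavittGen K (vertex w))) := by
          simp only [ghostPathElem_cons, pathElem_cons, mul_assoc]
      rw [key]
      by_cases hef : e = f
      · subst hef
        rw [leavittGen_ghost_mul_edge_self, ← hq.2.vertex_mul_pathElem,
          ← mul_assoc _ _ (pathElem _ _ _),
          leavittGen_vertex_mul_self, hq.2.vertex_mul_pathElem, ih hp.2 hq.2 (by simpa using hpq)]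
      · rw [leavittGen_ghost_mul_edge_of_ne K E hef, zero_mul, mul_zero]

/-! ### Spanning by monomials -/

theorem leavittGen_mem_adjoin (x : LeavittGen V A) :
    E.leavittGen K x ∈ NonUnitalAlgebra.adjoin K (Set.range (E.leavittGen K)) :=
  NonUnitalAlgebra.subset_adjoin K ⟨_, rfl⟩

theorem pathElem_mul_mem_adjoin (p : List A) {x : UnitalLeavitt K E}
    (hx : x ∈ NonUnitalAlgebra.adjoin K (Set.range (E.leavittGen K))) :
    E.pathElem K p * x ∈ NonUnitalAlgebra.adjoin K (Set.range (E.leavittGen K)) := by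
  induction p with
  | nil => simpa
  | cons e p ih =>
    rw [pathElem_cons, mul_assoc]
    exact mul_mem (leavittGen_mem_adjoin _) ih

theorem mul_ghostPathElem_mem_adjoin (p : List A) {x : UnitalLeavitt K E}
    (hx : x ∈ NonUnitalAlgebra.adjoin K (Set.range (E.leavittGen K))) :
    x * E.ghostPathElem K p ∈ NonUnitalAlgebra.adjoin K (Set.range (E.leavittGen K)) := by
  induction p with
  | nil => simpa
  | cons e p ih =>
    rw [ghostPathElem_cons, ← mul_assoc]
    exact mul_mem ih (leavittGen_mem_adjoin _)

variable (K E) in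
/-- The span of the monomials `p w q*`. -/
def monomialSpan : Submodule K (UnitalLeavitt K E) :=
  Submodule.span K {x | ∃ (p : List A) (w : V) (q : List A),
    E.pathElem K p * (E.leavittGen K (vertex w) * E.ghostPathElem K q) = x}

theorem monomial_mem_monomialSpan (p : List A) (w : V) (q : List A) :
    E.pathElem K p * (E.leavittGen K (vertex w) * E.ghostPathElem K q) ∈ E.monomialSpan K :=
  Submodule.subset_span ⟨p, w, q, rfl⟩

/-- An edge is prepended to `p`. A ghost edge cancels against the first edge of `p`, leaving a
vertex to absorb, or joins the ghost part when `p` is empty. -/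
theorem leavittGen_mul_mem_monomialSpan (g : LeavittGen V A) {x : UnitalLeavitt K E}
    (hx : x ∈ E.monomialSpan K) : E.leavittGen K g * x ∈ E.monomialSpan K := by
  have vertex_case : ∀ (v : V) (p : List A) (w : V) (q : List A),
      E.leavittGen K (vertex v) * (E.pathElem K p * (E.leavittGen K (vertex w) *
        E.ghostPathElem K q)) ∈ E.monomialSpan K := by
    intro v p w q
    cases p with
    | nil =>
      by_cases h : v = w
      · subst h
        rw [pathElem_nil, one_mul, ← mul_assoc, leavittGen_vertex_mul_self]
        simpa using monomial_mem_monomialSpan (K := K) (E := E) [] v q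
      · rw [pathElem_nil, one_mul, ← mul_assoc, leavittGen_vertex_mul_vertex_of_ne K E h, zero_mul]
        exact zero_mem _
    | cons f p =>
      rw [← mul_assoc]
      by_cases h : v = E.source f
      · subst h
        rw [pathElem_cons, ← mul_assoc (leavittGen _ _ _), leavittGen_source_mul_edge,
          ← pathElem_cons]
        exact monomial_mem_monomialSpan _ _ _
      · rw [pathElem_cons, ← mul_assoc (leavittGen _ _ _), leavittGen_vertex_mul_edge_of_ne K E h,
          zero_mul, zero_mul]
        exact zero_mem _
  induction hx using Submodule.span_induction with
  | zero => rw [mul_zero]; exact zero_mem _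
  | add x y _ _ hx hy => rw [mul_add]; exact add_mem hx hy
  | smul k x _ hx => rw [mul_smul_comm]; exact Submodule.smul_mem _ _ hx
  | mem x hx =>
    obtain ⟨p, w, q, rfl⟩ := hx
    cases g with
    | vertex v => exact vertex_case v p w q
    | edge e =>
      rw [← mul_assoc, ← pathElem_cons]
      exact monomial_mem_monomialSpan _ _ _
    | ghost e =>
      cases p with
      | nil =>
        rw [pathElem_nil, one_mul, ← mul_assoc]
        by_cases h : E.source e = w
        · subst h
          rw [leavittGen_ghost_mul_source, ← leavittGen_range_mul_ghost, mul_assoc,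
            ← ghostPathElem_concat]
          simpa using monomial_mem_monomialSpan (K := K) (E := E) [] (E.range e) (q ++ [e])
        · rw [leavittGen_ghost_mul_vertex_of_ne K E h, zero_mul]
          exact zero_mem _
      | cons f p =>
        rw [pathElem_cons, mul_assoc (leavittGen _ _ _), ← mul_assoc]
        by_cases h : e = f
        · subst h
          rw [leavittGen_ghost_mul_edge_self]
          exact vertex_case _ p w q
        · rw [leavittGen_ghost_mul_edge_of_ne K E h, zero_mul]
          exact zero_mem _

theorem mem_monomialSpan_of_mem_adjoin {x : UnitalLeavitt K E}
    (hx : x ∈ NonUnitalAlgebra.adjoin K (Set.range (E.leavittGen K))) :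
    x ∈ E.monomialSpan K := by
  -- The second half, stability of the span under left multiplication by `x`, is what carries the
  -- induction through products.
  suffices h : x ∈ E.monomialSpan K ∧ ∀ y ∈ E.monomialSpan K, x * y ∈ E.monomialSpan K from h.1
  induction hx using NonUnitalAlgebra.adjoin_induction with
  | zero => exact ⟨zero_mem _, fun y _ => by rw [zero_mul]; exact zero_mem _⟩
  | add x y _ _ hx hy =>
    exact ⟨add_mem hx.1 hy.1, fun z hz => by rw [add_mul]; exact add_mem (hx.2 z hz) (hy.2 z hz)⟩
  | mul x y _ _ hx hy =>
    exact ⟨hx.2 y hy.1, fun z hz => by rw [mul_assoc]; exact hx.2 _ (hy.2 z hz)⟩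
  | smul k x _ hx =>
    exact ⟨Submodule.smul_mem _ _ hx.1,
      fun z hz => by rw [smul_mul_assoc]; exact Submodule.smul_mem _ _ (hx.2 z hz)⟩
  | mem x hx =>
    obtain ⟨g, rfl⟩ := hx
    refine ⟨?_, fun y hy => leavittGen_mul_mem_monomialSpan g hy⟩
    cases g with
    | vertex v => simpa using monomial_mem_monomialSpan (K := K) (E := E) [] v []
    | edge e =>
      simpa [pathElem_cons, leavittGen_edge_mul_range] using
        monomial_mem_monomialSpan (K := K) (E := E) [e] (E.range e) []
    | ghost e =>
      simpa [ghostPathElem_cons, leavittGen_range_mul_ghost] using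
        monomial_mem_monomialSpan (K := K) (E := E) [] (E.range e) [e]

/-! ### From a nonzero element of `Lu` back to `u` -/

variable (K E) in
/-- The span of the elements `p w` for a fixed vertex `w`. -/
def pathSpan (w : V) : Submodule K (UnitalLeavitt K E) :=
  Submodule.span K (Set.range fun p : List A => E.pathElem K p * E.leavittGen K (vertex w))

theorem IsPath.mul_pathElem_mem_pathSpan {v w : V} {t : List A} (ht : E.IsPath v t w)
    {y : UnitalLeavitt K E} (hy : y ∈ E.pathSpan K v) : y * E.pathElem K t ∈ E.pathSpan K w := by
  induction hy using Submodule.span_induction with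
  | zero => rw [zero_mul]; exact zero_mem _
  | add x y _ _ hx hy => rw [add_mul]; exact add_mem hx hy
  | smul k x _ hx => rw [smul_mul_assoc]; exact Submodule.smul_mem _ _ hx
  | mem x hx =>
    obtain ⟨p, rfl⟩ := hx
    refine Submodule.subset_span ⟨p ++ t, ?_⟩
    simp only [pathElem_append]
    rw [mul_assoc, mul_assoc, ht.vertex_mul_pathElem]

/-- For a monomial `p w q*` the path `q` works, unless the product with `u` is zero. For a sum, the
two paths are comparable and the longer one serves both terms. -/
theorem IsLinePoint.exists_mul_pathElem_mem_pathSpan {u : V} (hu : E.IsLinePoint u)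
    {x : UnitalLeavitt K E} (hx : x ∈ E.monomialSpan K) :
    ∃ q w, E.IsPath u q w ∧
      x * E.leavittGen K (vertex u) * E.pathElem K q ∈ E.pathSpan K w := by
  induction hx using Submodule.span_induction with
  | zero => exact ⟨[], u, rfl, by simp⟩
  | smul k x _ hx =>
    obtain ⟨q, w, hq, h⟩ := hx
    exact ⟨q, w, hq, by simpa using Submodule.smul_mem _ k h⟩
  | add x y _ _ hx hy =>
    obtain ⟨q, w, hq, h⟩ := hx
    obtain ⟨q', w', hq', h'⟩ := hy
    rcases hu.exists_append_of_isPath hq hq' with ⟨t, ht, rfl⟩ | ⟨t, ht, rfl⟩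
    · refine ⟨_, w', hq', ?_⟩
      rw [add_mul, add_mul]
      refine add_mem ?_ h'
      rw [pathElem_append, ← mul_assoc]
      exact ht.mul_pathElem_mem_pathSpan h
    · refine ⟨_, w, hq, ?_⟩
      rw [add_mul, add_mul]
      refine add_mem h ?_
      rw [pathElem_append, ← mul_assoc]
      exact ht.mul_pathElem_mem_pathSpan h'
  | mem x hx =>
    obtain ⟨p, w, q, rfl⟩ := hx
    rcases vertex_mul_ghostPathElem_mul_vertex_eq_zero_or (K := K) (E := E) q u w with h | h
    · refine ⟨[], u, rfl, ?_⟩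
      rw [mul_assoc (pathElem _ _ _), h]
      simp
    · refine ⟨q, w, h, Submodule.subset_span ⟨p, ?_⟩⟩
      simp only [mul_assoc]
      rw [h.vertex_mul_pathElem, h.ghostPathElem_mul_pathElem, leavittGen_vertex_mul_self]

/-- Multiplication by `w p*`, for a `p` whose term is nonzero, isolates the coefficient of `p` by
orthogonality. -/
theorem IsLinePoint.exists_mul_eq_smul_vertex {w : V} (hw : E.IsLinePoint w)
    {y : UnitalLeavitt K E} (hy : y ∈ E.pathSpan K w) (hy0 : y ≠ 0) :
    ∃ (p : List A) (k : K), k ≠ 0 ∧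
      E.leavittGen K (vertex w) * E.ghostPathElem K p * y = k • E.leavittGen K (vertex w) := by
  obtain ⟨c, rfl⟩ := (Finsupp.mem_span_range_iff_exists_finsupp).1 hy
  obtain ⟨p, hpc, hp⟩ := Finset.exists_ne_zero_of_sum_ne_zero hy0
  have hk : c p ≠ 0 := fun h => hp (by simp [h])
  have hp0 : E.pathElem K p * E.leavittGen K (vertex w) ≠ 0 := fun h => hp (by simp [h])
  obtain ⟨v, hv⟩ := (pathElem_mul_vertex_eq_zero_or p w).resolve_left hp0
  refine ⟨p, c p, hk, ?_⟩
  rw [Finsupp.sum, Finset.mul_sum, Finset.sum_eq_single p]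
  · rw [mul_smul_comm, mul_assoc, hv.ghostPathElem_mul_pathElem, leavittGen_vertex_mul_self]
  · intro q _ hqp
    rw [mul_smul_comm]
    rcases pathElem_mul_vertex_eq_zero_or (K := K) (E := E) q w with h | ⟨v', hv'⟩
    · rw [h, mul_zero, smul_zero]
    · by_cases hvv : v = v'
      · subst hvv
        rw [mul_assoc, hw.ghostPathElem_mul_pathElem_of_ne hv hv' hqp.symm, mul_zero, smul_zero]
      -- Paths with different sources are orthogonal because their source vertices are.
      · rw [← hv.ghostPathElem_mul_vertex, ← hv'.vertex_mul_pathElem, mul_assoc, ← mul_assoc _ _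
          (pathElem _ _ _), leavittGen_vertex_mul_vertex_of_ne K E hvv, zero_mul, mul_zero,
          smul_zero]
  · intro h; exact absurd hpc h

theorem IsLinePoint.exists_mul_eq_vertex {u : V} (hu : E.IsLinePoint u) {x : UnitalLeavitt K E}
    (hx : x ∈ NonUnitalAlgebra.adjoin K (Set.range (E.leavittGen K)))
    (hxu : x * E.leavittGen K (vertex u) = x) (hx0 : x ≠ 0) :
    ∃ a ∈ NonUnitalAlgebra.adjoin K (Set.range (E.leavittGen K)),
      a * x = E.leavittGen K (vertex u) := by
  obtain ⟨q, w, hq, hy⟩ :=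
    hu.exists_mul_pathElem_mem_pathSpan (mem_monomialSpan_of_mem_adjoin hx)
  rw [hxu] at hy
  have hqq := hu.pathElem_mul_ghostPathElem (K := K) hq
  -- Right multiplication by `q` is undone by `w q*`, so `xq` is nonzero.
  have hxq : x * E.pathElem K q * (E.leavittGen K (vertex w) * E.ghostPathElem K q) = x := by
    rw [mul_assoc, hqq, hxu]
  obtain ⟨p, k, hk, h⟩ := (hu.of_mem_tree ⟨q, hq⟩).exists_mul_eq_smul_vertex hy
    (fun h => hx0 (by rw [← hxq, h, zero_mul]))
  -- With `x = (xq)(w q*)` and `(w p*)(xq) = k w`, the left factor `k⁻¹ q w p*` yields `q w q* = u`.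
  refine ⟨k⁻¹ • (E.pathElem K q * (E.leavittGen K (vertex w) * E.ghostPathElem K p)),
    SMulMemClass.smul_mem _ (pathElem_mul_mem_adjoin _
      (mul_ghostPathElem_mem_adjoin _ (leavittGen_mem_adjoin _))), ?_⟩
  calc _ = k⁻¹ • (E.pathElem K q * ((E.leavittGen K (vertex w) * E.ghostPathElem K p *
        (x * E.pathElem K q)) * (E.leavittGen K (vertex w) * E.ghostPathElem K q))) := by
        rw [smul_mul_assoc, mul_assoc _ (x * _), hxq, mul_assoc]
    _ = _ := by
      rw [h, smul_mul_assoc, mul_smul_comm, smul_smul, inv_mul_cancel₀ hk, one_smul, ← mul_assoc _ _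
        (ghostPathElem _ _ _), leavittGen_vertex_mul_self, hqq]

end Relations

/-! ### Representations detecting nonzero elements -/

section Representation

variable {V : Type*} {A : Type*}

/-- A branching of `E`: a family of maps `enc e : κ → κ` such that, for every vertex `v` that is
not a sink, `(e, k) ↦ enc e k` is a bijection from `s⁻¹(v) × κ` to `κ`. -/
structure IsBranching (E : DirectedGraph V A) {κ : Type*} (enc : A → κ → κ) : Prop where
  inj : ∀ e f k l, E.source e = E.source f → enc e k = enc f l → e = f ∧ k = l
  surj : ∀ v k, (E.emitted v).Nonempty → ∃ e l, E.source e = v ∧ enc e l = k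

open Cardinal in
/-- There is a branching that is trivial at the vertices that emit only one edge. -/
theorem exists_isBranching (E : DirectedGraph V A) :
    ∃ enc : A → ℕ ⊕ A → ℕ ⊕ A, E.IsBranching enc ∧
      ∀ e k, ¬ E.IsBifurcation (E.source e) → enc e k = k := by
  have key : ∀ v, (E.emitted v).Nonempty → ∃ φ : E.emitted v × (ℕ ⊕ A) ≃ ℕ ⊕ A,
      ¬ E.IsBifurcation v → ∀ x, φ x = x.2 := by
    intro v hv
    by_cases hb : E.IsBifurcation v
    · have : #(E.emitted v × (ℕ ⊕ A)) = #(ℕ ⊕ A) := by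
        have h0 : #(E.emitted v) ≤ #(ℕ ⊕ A) :=
          mk_le_of_injective (f := fun x => Sum.inr x.1)
            (fun x y h => Subtype.ext (Sum.inr_injective h))
        have : #(E.emitted v) ≠ 0 := by
          have := hv.to_subtype
          exact mk_ne_zero _
        rw [mk_prod, lift_id, lift_id]
        exact mul_eq_right (aleph0_le_mk _) h0 this
      obtain ⟨φ⟩ := Cardinal.eq.1 this
      exact ⟨φ, fun h => absurd hb h⟩
    · obtain ⟨e, he⟩ := hv
      have hs : Subsingleton (E.emitted v) := (Set.not_nontrivial_iff.1 hb).coe_sort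
      exact ⟨⟨Prod.snd, fun k => (⟨e, he⟩, k), fun x => Prod.ext (Subsingleton.elim _ _) rfl,
        fun _ => rfl⟩, fun _ _ => rfl⟩
  choose φ hφ using key
  have enc_eq : ∀ (v : V) (e : A) (k : ℕ ⊕ A) (h : E.source e = v),
      φ (E.source e) ⟨e, rfl⟩ (⟨e, rfl⟩, k) = φ v ⟨e, h⟩ (⟨e, h⟩, k) := by
    rintro v e k rfl; rfl
  refine ⟨fun e k => φ (E.source e) ⟨e, rfl⟩ (⟨e, rfl⟩, k), ⟨?_, ?_⟩, ?_⟩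
  · intro e f k l h hkl
    rw [enc_eq _ e k h] at hkl
    have := (φ _ _).injective hkl
    exact ⟨congrArg (fun x => (x.1 : A)) this, congrArg Prod.snd this⟩
  · intro v k hv
    refine ⟨((φ v hv).symm k).1, ((φ v hv).symm k).2, ((φ v hv).symm k).1.2, ?_⟩
    rw [enc_eq v _ _ ((φ v hv).symm k).1.2]
    simp
  · intro e k h
    exact hφ _ _ h _

open Classical in
/-- The operators by which the generators act on functions `V × κ → R`; edges are twisted by the
unit `t`. -/
noncomputable def branchingOp (K : Type*) [Field K] (E : DirectedGraph V A) {κ : Type*}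
    (enc : A → κ → κ) {R : Type*} [CommRing R] [Algebra K R] (t : Rˣ) :
    LeavittGen V A → Module.End K (V × κ → R)
  | vertex v =>
    { toFun := fun f x => if x.1 = v then f x else 0
      map_add' := fun f g => by ext x; by_cases h : x.1 = v <;> simp [h]
      map_smul' := fun c f => by ext x; by_cases h : x.1 = v <;> simp [h] }
  | edge e =>
    -- Transport along `(r(e), k) ↦ (s(e), enc e k)`, extended by zero; for a branching the chosen
    -- `k` is unique.
    { toFun := fun f x => if h : ∃ k, (E.source e, enc e k) = x then t * f (E.range e, h.choose)
        else 0
      map_add' := fun f g => by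
        ext x; by_cases h : ∃ k, (E.source e, enc e k) = x <;> simp [h, mul_add]
      map_smul' := fun c f => by
        ext x; by_cases h : ∃ k, (E.source e, enc e k) = x <;> simp [h] }
  | ghost e =>
    { toFun := fun f x => if x.1 = E.range e then ↑t⁻¹ * f (E.source e, enc e x.2) else 0
      map_add' := fun f g => by ext x; by_cases h : x.1 = E.range e <;> simp [h, mul_add]
      map_smul' := fun c f => by ext x; by_cases h : x.1 = E.range e <;> simp [h] }

variable {K : Type*} [Field K] {E : DirectedGraph V A} {κ : Type*} {enc : A → κ → κ}
  {R : Type*} [CommRing R] [Algebra K R] {t : Rˣ}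

open Classical in
theorem branchingOp_vertex_apply (v : V) (f : V × κ → R) (x : V × κ) :
    E.branchingOp K enc t (vertex v) f x = if x.1 = v then f x else 0 := rfl

open Classical in
theorem branchingOp_ghost_apply (e : A) (f : V × κ → R) (x : V × κ) :
    E.branchingOp K enc t (ghost e) f x =
      if x.1 = E.range e then ↑t⁻¹ * f (E.source e, enc e x.2) else 0 := rfl

theorem branchingOp_edge_apply_of_forall_ne (e : A) (f : V × κ → R) (x : V × κ)
    (h : ∀ k, (E.source e, enc e k) ≠ x) : E.branchingOp K enc t (edge e) f x = 0 :=
  dif_neg (by simpa using h)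

theorem IsBranching.branchingOp_edge_apply (hE : E.IsBranching enc) (e : A) (f : V × κ → R)
    (k : κ) :
    E.branchingOp K enc t (edge e) f (E.source e, enc e k) = t * f (E.range e, k) := by
  have h : ∃ l, (E.source e, enc e l) = (E.source e, enc e k) := ⟨k, rfl⟩
  have hk : h.choose = k := (hE.inj e e _ _ rfl (Prod.ext_iff.1 h.choose_spec).2).2
  calc _ = t * f (E.range e, h.choose) := dif_pos h
    _ = _ := by rw [hk]

/-- Injectivity of the branching gives relation (3), since images of distinct edges are disjoint.
With surjectivity it gives (4): each point over a regular vertex lies in the image of exactly one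
edge. The factors `t` and `t⁻¹` cancel in both. -/
theorem IsBranching.branchingOp_rel (hE : E.IsBranching enc) (t : Rˣ)
    {x y : FreeAlgebra K (LeavittGen V A)} (h : LeavittRel K E x y) :
    FreeAlgebra.lift K (E.branchingOp K enc t) x = FreeAlgebra.lift K (E.branchingOp K enc t) y := by
  induction h with
  | idem v =>
    ext f x
    simp +contextual [branchingOp_vertex_apply]
  | orth v w h =>
    ext f x
    simp only [map_mul, FreeAlgebra.lift_ι_apply, Module.End.mul_apply, branchingOp_vertex_apply,
      map_zero, LinearMap.zero_apply, Pi.zero_apply]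
    split_ifs with h1 h2
    · exact absurd (h1.symm.trans h2) h
    · rfl
    · rfl
  | source_edge e =>
    ext f x
    simp only [map_mul, FreeAlgebra.lift_ι_apply, Module.End.mul_apply, branchingOp_vertex_apply]
    split_ifs with h
    · rfl
    · rw [branchingOp_edge_apply_of_forall_ne]
      rintro k rfl
      exact h rfl
  | edge_range e =>
    ext f x
    simp only [map_mul, FreeAlgebra.lift_ι_apply, Module.End.mul_apply]
    by_cases h : ∃ k, (E.source e, enc e k) = x
    · obtain ⟨k, rfl⟩ := h
      simp [hE.branchingOp_edge_apply, branchingOp_vertex_apply]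
    · push Not at h
      rw [branchingOp_edge_apply_of_forall_ne _ _ _ h, branchingOp_edge_apply_of_forall_ne _ _ _ h]
  | range_ghost e =>
    ext f x
    simp +contextual [branchingOp_vertex_apply, branchingOp_ghost_apply]
  | ghost_source e =>
    ext f x
    simp [branchingOp_vertex_apply, branchingOp_ghost_apply]
  | ghost_edge_self e =>
    ext f ⟨v, k⟩
    simp only [map_mul, FreeAlgebra.lift_ι_apply, Module.End.mul_apply, branchingOp_vertex_apply,
      branchingOp_ghost_apply, hE.branchingOp_edge_apply, Units.inv_mul_cancel_left]
    split_ifs with h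
    · rw [h]
    · rfl
  | ghost_edge_ne e f h =>
    ext g x
    simp only [map_mul, FreeAlgebra.lift_ι_apply, Module.End.mul_apply,
      branchingOp_ghost_apply, map_zero, LinearMap.zero_apply, Pi.zero_apply]
    rw [branchingOp_edge_apply_of_forall_ne, mul_zero, ite_self]
    intro k hk
    obtain ⟨h1, h2⟩ := Prod.ext_iff.1 hk
    exact h (hE.inj f e _ _ h1 h2).1.symm
  | regular v h =>
    ext f ⟨w, k⟩
    simp only [map_mul, map_sum, FreeAlgebra.lift_ι_apply, LinearMap.sum_apply, Finset.sum_apply,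
      Module.End.mul_apply, branchingOp_vertex_apply]
    split_ifs with hw
    · obtain rfl : w = v := hw
      obtain ⟨e, l, rfl, rfl⟩ := hE.surj w k h.1
      rw [Finset.sum_eq_single e, hE.branchingOp_edge_apply, branchingOp_ghost_apply, if_pos rfl,
        Units.mul_inv_cancel_left]
      · intro e' _ hne
        rw [branchingOp_edge_apply_of_forall_ne]
        intro k hk
        obtain ⟨h1, h2⟩ := Prod.ext_iff.1 hk
        exact hne (hE.inj _ _ _ _ h1 h2).1
      · intro he
        exact absurd (h.2.mem_toFinset.2 rfl) he
    · refine (Finset.sum_eq_zero fun e he => ?_).symm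
      rw [branchingOp_edge_apply_of_forall_ne]
      rintro l hl
      exact hw ((Prod.ext_iff.1 hl).1.symm.trans (h.2.mem_toFinset.1 he))

/-- The representation of the Leavitt path algebra given by a branching. -/
noncomputable def IsBranching.rep (hE : E.IsBranching enc) (t : Rˣ) :
    UnitalLeavitt K E →ₐ[K] Module.End K (V × κ → R) :=
  RingQuot.liftAlgHom K ⟨FreeAlgebra.lift K (E.branchingOp K enc t), fun _ _ h =>
    hE.branchingOp_rel t h⟩

theorem IsBranching.rep_leavittGen (hE : E.IsBranching enc) (t : Rˣ) (x : LeavittGen V A) :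
    hE.rep (K := K) t (E.leavittGen K x) = E.branchingOp K enc t x := by
  simp [rep, leavittGen]

open Classical in
theorem IsBranching.rep_vertex_apply (hE : E.IsBranching enc) (v : V) (f : V × κ → R)
    (x : V × κ) :
    hE.rep (K := K) t (E.leavittGen K (vertex v)) f x = if x.1 = v then f x else 0 := by
  rw [hE.rep_leavittGen, branchingOp_vertex_apply]

/-- Without bifurcations the label `k` never changes, so each edge only contributes a factor `t`. -/
theorem IsBranching.rep_pathElem_apply (hE : E.IsBranching enc) {v w : V} {p : List A}
    (hp : E.IsPath v p w) (hb : ∀ x ∈ E.tree v, ¬ E.IsBifurcation x)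
    (henc : ∀ e k, ¬ E.IsBifurcation (E.source e) → enc e k = k) (f : V × κ → R) (k : κ) :
    hE.rep (K := K) t (E.pathElem K p) f (v, k) = (t : R) ^ p.length * f (w, k) := by
  induction p generalizing v with
  | nil => obtain rfl : v = w := hp; simp
  | cons e p ih =>
    obtain ⟨rfl, hp⟩ := hp
    have h := ih hp fun x hx => hb x (mem_tree_trans ⟨[e], rfl, rfl⟩ hx)
    rw [pathElem_cons, map_mul, Module.End.mul_apply, hE.rep_leavittGen]
    have hk := hE.branchingOp_edge_apply (K := K) (t := t) e (hE.rep (K := K) t (E.pathElem K p) f) k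
    rw [henc e k (hb _ ⟨[], rfl⟩)] at hk
    rw [hk, h, List.length_cons, pow_succ', mul_assoc]

variable (K E) in
theorem leavittGen_vertex_ne_zero (v : V) : E.leavittGen K (vertex v) ≠ 0 := by
  intro h
  obtain ⟨enc, hE, -⟩ := exists_isBranching E
  have := hE.rep_vertex_apply (K := K) (t := (1 : Kˣ)) v (fun _ => 1) (v, Sum.inl 0)
  rw [h] at this
  simp at this

/-- Over `K(X)` with `t = X`, the closed path acts at `w` as `X ^ n` with `n > 0`, which differs
from `1`. -/
theorem vertex_sub_pathElem_ne_zero {w : V} {p : List A} (hp : E.IsPath w p w) (hp0 : p ≠ [])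
    (hb : ∀ x ∈ E.tree w, ¬ E.IsBifurcation x) :
    E.leavittGen K (vertex w) - E.pathElem K p * E.leavittGen K (vertex w) ≠ 0 := by
  intro h
  obtain ⟨enc, hE, henc⟩ := exists_isBranching E
  let t : (RatFunc K)ˣ := Units.mk0 RatFunc.X RatFunc.X_ne_zero
  have h1 := congrArg (fun y => hE.rep (K := K) t y (fun _ => 1) (w, Sum.inl 0)) h
  simp only [map_sub, map_mul, LinearMap.sub_apply, Pi.sub_apply, Module.End.mul_apply,
    hE.rep_pathElem_apply hp hb henc, hE.rep_vertex_apply, if_true, map_zero,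
    LinearMap.zero_apply, Pi.zero_apply, mul_one, t, Units.val_mk0] at h1
  have h2 : algebraMap (Polynomial K) (RatFunc K) (Polynomial.X ^ p.length) =
      algebraMap (Polynomial K) (RatFunc K) 1 := by
    rw [map_pow, RatFunc.algebraMap_X, map_one]
    exact (sub_eq_zero.1 h1).symm
  have h3 := congrArg Polynomial.natDegree (RatFunc.algebraMap_injective K h2)
  simp [hp0] at h3

/-- With `t = 1` the closed path fixes the constant function `1` at `w`. Thus `w - p w` kills that
function, while `w` does not. -/
theorem mul_vertex_sub_pathElem_ne_vertex {w : V} {p : List A} (hp : E.IsPath w p w)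
    (hb : ∀ x ∈ E.tree w, ¬ E.IsBifurcation x) (a : UnitalLeavitt K E) :
    a * (E.leavittGen K (vertex w) - E.pathElem K p * E.leavittGen K (vertex w)) ≠
      E.leavittGen K (vertex w) := by
  classical
  intro h
  obtain ⟨enc, hE, henc⟩ := exists_isBranching E
  have hv : E.leavittGen K (vertex w) * (E.leavittGen K (vertex w) -
      E.pathElem K p * E.leavittGen K (vertex w)) =
      E.leavittGen K (vertex w) - E.pathElem K p * E.leavittGen K (vertex w) := by
    rw [mul_sub, leavittGen_vertex_mul_self, ← mul_assoc, hp.vertex_mul_pathElem, mul_assoc,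
      leavittGen_vertex_mul_self]
  have h0 : hE.rep (K := K) (1 : Kˣ) (E.leavittGen K (vertex w) -
      E.pathElem K p * E.leavittGen K (vertex w)) (fun _ => 1) = 0 := by
    ext ⟨v, k⟩
    rw [← hv, map_mul, Module.End.mul_apply, hE.rep_vertex_apply]
    split_ifs with hvw
    · obtain rfl : v = w := hvw
      simp [hE.rep_pathElem_apply hp hb henc, hE.rep_vertex_apply]
    · rfl
  have h1 := congrArg (fun y => hE.rep (K := K) (1 : Kˣ) y (fun _ => 1) (w, Sum.inl 0)) h
  simp only [map_mul, Module.End.mul_apply, h0, map_zero, hE.rep_vertex_apply] at h1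
  simp at h1

end Representation

/-! ### Corners and minimal left ideals -/

section Minimality

variable {V : Type*} {A : Type*} {K : Type*} [Field K] {E : DirectedGraph V A}

variable (K E) in
/-- Every nonzero element of the corner `v L v` generates the left ideal `L v`. -/
def IsCornerMinimal (v : V) : Prop :=
  ∀ x ∈ NonUnitalAlgebra.adjoin K (Set.range (E.leavittGen K)),
    E.leavittGen K (vertex v) * x = x → x * E.leavittGen K (vertex v) = x → x ≠ 0 →
      ∃ a : UnitalLeavitt K E, a * x = E.leavittGen K (vertex v)

/-- For `x = ux = xu` nonzero, `Lx` contains `x` and lies in `Lu`, hence equals `Lu` and contains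
`u`. -/
theorem isCornerMinimal_of_isMinimalLeftIdeal {u : V}
    (h : IsMinimalLeftIdeal (leftMultiples K (E.vertexElem K u))) : E.IsCornerMinimal K u := by
  intro x hx hux hxu hx0
  obtain ⟨-, -, hmin⟩ := h
  let y : LeavittPathAlgebra K E := ⟨x, hx⟩
  have hy : y ∈ leftMultiples K y := ⟨E.vertexElem K u, Subtype.ext hux⟩
  have huu : E.vertexElem K u ∈ leftMultiples K (E.vertexElem K u) :=
    ⟨E.vertexElem K u, Subtype.ext (leavittGen_vertex_mul_self K E u)⟩
  have hJl : IsLeftIdeal (leftMultiples K y) := by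
    rintro a _ ⟨b, rfl⟩
    exact ⟨a * b, mul_assoc _ _ _⟩
  have hJu : leftMultiples K y ≤ leftMultiples K (E.vertexElem K u) := by
    rintro _ ⟨b, rfl⟩
    exact ⟨b * y, by rw [mul_assoc]; congr 1; exact Subtype.ext hxu⟩
  rcases hmin _ hJl hJu with hJ | hJ
  · rw [hJ, Submodule.mem_bot] at hy
    exact absurd (congrArg Subtype.val hy) hx0
  · rw [← hJ] at huu
    obtain ⟨a, ha⟩ := huu
    exact ⟨a, congrArg Subtype.val ha⟩

/-- The map `x ↦ p x p*` embeds `wLw` into `uLu`, as `p* p w = w`. If `a` sends `p x p*` to `u`,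
then `p* a p` sends `x` to `w`. -/
theorem IsCornerMinimal.of_isPath {u w : V} {p : List A} (hu : E.IsCornerMinimal K u)
    (hp : E.IsPath u p w) : E.IsCornerMinimal K w := by
  intro x hx hwx hxw hx0
  have hxp : x * (E.ghostPathElem K p * (E.pathElem K p * E.leavittGen K (vertex w))) = x := by
    rw [hp.ghostPathElem_mul_pathElem, hxw]
  have hpx : E.ghostPathElem K p * (E.pathElem K p * x) = x := by
    rw [← hwx, ← mul_assoc (pathElem _ _ _), ← mul_assoc, hp.ghostPathElem_mul_pathElem]
  have h1 : E.leavittGen K (vertex u) * (E.pathElem K p * x * E.ghostPathElem K p) =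
      E.pathElem K p * x * E.ghostPathElem K p := by
    rw [← mul_assoc, ← mul_assoc, hp.vertex_mul_pathElem, mul_assoc (pathElem _ _ _), hwx]
  have h2 : E.pathElem K p * x * E.ghostPathElem K p * E.leavittGen K (vertex u) =
      E.pathElem K p * x * E.ghostPathElem K p := by
    rw [mul_assoc, hp.ghostPathElem_mul_vertex, ← mul_assoc, mul_assoc _ x, hxw]
  have h3 : E.pathElem K p * x * E.ghostPathElem K p ≠ 0 := by
    intro h0
    apply hx0
    calc x = E.ghostPathElem K p * (E.pathElem K p * (x * (E.ghostPathElem K p * (E.pathElem K p *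
          E.leavittGen K (vertex w))))) := by rw [hxp, hpx]
      _ = E.ghostPathElem K p * (E.pathElem K p * x * E.ghostPathElem K p * (E.pathElem K p *
          E.leavittGen K (vertex w))) := by simp only [mul_assoc]
      _ = 0 := by rw [h0, zero_mul, mul_zero]
  obtain ⟨a, ha⟩ := hu _
    (mul_ghostPathElem_mem_adjoin _ (pathElem_mul_mem_adjoin _ hx)) h1 h2 h3
  refine ⟨E.ghostPathElem K p * (a * E.pathElem K p), ?_⟩
  calc _ = E.ghostPathElem K p * (a * (E.pathElem K p * (x * (E.ghostPathElem K p *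
        (E.pathElem K p * E.leavittGen K (vertex w)))))) := by
        rw [hxp]; simp only [mul_assoc]
    _ = E.ghostPathElem K p * (a * (E.pathElem K p * x * E.ghostPathElem K p) *
        (E.pathElem K p * E.leavittGen K (vertex w))) := by
        simp only [mul_assoc]
    _ = _ := by
      rw [ha, ← mul_assoc _ (pathElem _ _ _), hp.vertex_mul_pathElem, mul_assoc (pathElem _ _ _),
        leavittGen_vertex_mul_self, hp.ghostPathElem_mul_pathElem]

/-- If `a e e* = w`, then `f = w f = a e e* f = 0` for a second edge `f`, which forces the vertex
`r(f) = f* f` to vanish. -/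
theorem IsCornerMinimal.not_isBifurcation {w : V} (hw : E.IsCornerMinimal K w) :
    ¬ E.IsBifurcation w := by
  rintro ⟨e, he, f, hf, hef⟩
  obtain rfl : E.source e = w := he
  have h0 : E.leavittGen K (edge e) * E.leavittGen K (ghost e) ≠ 0 := by
    intro h0
    apply leavittGen_vertex_ne_zero K E (E.range e)
    calc _ = E.leavittGen K (ghost e) * E.leavittGen K (edge e) *
          (E.leavittGen K (ghost e) * E.leavittGen K (edge e)) := by
          rw [leavittGen_ghost_mul_edge_self, leavittGen_vertex_mul_self]
      _ = E.leavittGen K (ghost e) * (E.leavittGen K (edge e) *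
          E.leavittGen K (ghost e)) * E.leavittGen K (edge e) := by simp only [mul_assoc]
      _ = 0 := by rw [h0, mul_zero, zero_mul]
  obtain ⟨a, ha⟩ := hw (E.leavittGen K (edge e) * E.leavittGen K (ghost e))
    (mul_mem (leavittGen_mem_adjoin _) (leavittGen_mem_adjoin _))
    (by rw [← mul_assoc, leavittGen_source_mul_edge])
    (by rw [mul_assoc, leavittGen_ghost_mul_source]) h0
  have h1 : E.leavittGen K (edge f) = 0 := by
    have hf' := leavittGen_source_mul_edge K E f
    rw [show E.source f = E.source e from hf, ← ha, mul_assoc, mul_assoc,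
      leavittGen_ghost_mul_edge_of_ne K E hef, mul_zero, mul_zero] at hf'
    exact hf'.symm
  apply leavittGen_vertex_ne_zero K E (E.range f)
  rw [← leavittGen_ghost_mul_edge_self, h1, mul_zero]

/-- Bifurcations are excluded first, because the action of `w - c` is computed only in a tree
without them. -/
theorem IsCornerMinimal.isLinePoint {u : V} (hu : E.IsCornerMinimal K u) : E.IsLinePoint u := by
  have hb : ∀ w ∈ E.tree u, ¬ E.IsBifurcation w := by
    rintro w ⟨p, hp⟩
    exact (hu.of_isPath hp).not_isBifurcation
  rintro w hw
  refine ⟨hb w hw, ?_⟩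
  rintro ⟨c, hc0, hc, -⟩
  have hbw : ∀ x ∈ E.tree w, ¬ E.IsBifurcation x := fun x hx => hb x (mem_tree_trans hw hx)
  obtain ⟨p, hp⟩ := hw
  obtain ⟨a, ha⟩ := hu.of_isPath hp
    (E.leavittGen K (vertex w) - E.pathElem K c * E.leavittGen K (vertex w))
    (sub_mem (leavittGen_mem_adjoin _) (pathElem_mul_mem_adjoin _ (leavittGen_mem_adjoin _)))
    (by rw [mul_sub, leavittGen_vertex_mul_self, ← mul_assoc, hc.vertex_mul_pathElem, mul_assoc,
          leavittGen_vertex_mul_self])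
    (by rw [sub_mul, mul_assoc, leavittGen_vertex_mul_self])
    (vertex_sub_pathElem_ne_zero hc hc0 hbw)
  exact mul_vertex_sub_pathElem_ne_vertex hc hbw a ha

theorem IsLinePoint.isMinimalLeftIdeal {u : V} (hu : E.IsLinePoint u) :
    IsMinimalLeftIdeal (leftMultiples K (E.vertexElem K u)) := by
  have huu : E.vertexElem K u * E.vertexElem K u = E.vertexElem K u :=
    Subtype.ext (leavittGen_vertex_mul_self K E u)
  refine ⟨?_, ?_, fun J hJ hJu => or_iff_not_imp_left.2 fun hJ0 => le_antisymm hJu ?_⟩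
  · rintro a _ ⟨b, rfl⟩
    exact ⟨a * b, mul_assoc _ _ _⟩
  · intro h
    have : E.vertexElem K u ∈ leftMultiples K (E.vertexElem K u) := ⟨_, huu⟩
    rw [h, Submodule.mem_bot] at this
    exact leavittGen_vertex_ne_zero K E u (congrArg Subtype.val this)
  · obtain ⟨x, hx, hx0⟩ := Submodule.exists_mem_ne_zero_of_ne_bot hJ0
    have hxu : x * E.vertexElem K u = x := by
      obtain ⟨b, rfl⟩ := hJu hx
      rw [mul_assoc, huu]
    obtain ⟨a, ha, h⟩ := hu.exists_mul_eq_vertex x.2 (congrArg Subtype.val hxu)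
      (fun h => hx0 (Subtype.ext h))
    have hmem : E.vertexElem K u ∈ J := by
      have : (⟨a, ha⟩ : LeavittPathAlgebra K E) * x = E.vertexElem K u := Subtype.ext h
      exact this ▸ hJ _ _ hx
    rintro _ ⟨b, rfl⟩
    exact hJ _ _ hmem

end Minimality

end DirectedGraph

theorem mainTheorem3 {V : Type*} {A : Type*} (K : Type*) [Field K] (E : DirectedGraph V A)
    (u : V) :
    IsMinimalLeftIdeal (leftMultiples K (E.vertexElem K u)) ↔ E.IsLinePoint u :=
  ⟨fun h => (DirectedGraph.isCornerMinimal_of_isMinimalLeftIdeal h).isLinePoint,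
    fun h => h.isMinimalLeftIdeal⟩
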